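/- Fix constants $\bar b,L,\bar c>0$ and let $\mathcal U_c$ be the set of functions $u:[0,\bar b]\to\mathbb R$ that are increasing, concave, Lipschitz with modulus at most $L$, and satisfy $u(0)=0$, $u(\bar b)=1$. Let $(W_k,Y_k)$, $k=1,\dots,K$ ($K\ge 1$), be given pairs of lotteries with finite supports in $[0,\bar b]$. Let $0=y_1<\dots<y_N=\bar b$ be the elements of $\{0,\bar b\}\cup\bigcup_k(\operatorname{supp}W_k\cup\operatorname{supp}Y_k)$, let $p^k_j=\mathbb P[W_k=y_j]-\mathbb P[Y_k=y_j]$, let $P\in\mathbb R^{K\times(N-1)}$ have rows $(p^k_2,\dots,p^k_N)$, and put $\Sigma_D=\frac1K P^\top P$, $R_D=\operatorname{rank}\Sigma_D$, $Q=[\mathbf 0,\mathbf I_{N-1}]\in\mathbb R^{(N-1)\times N}$, $\omega=\frac1{2+2e^{2\bar c}}$. Model: there are a true utility function $u^*\in\mathcal U_c$ and a true scale $\sigma^*\in[1/\bar c,\infty)$. With $2K$ i.i.d. errors $\varepsilon_{k,1},\varepsilon_{k,2}\sim\mathrm{Gumbel}(0,\sigma^*)$, i.e. with density $\frac1{\sigma^*}e^{-x/\sigma^*}e^{-e^{-x/\sigma^*}}$,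 the response to query $k$ is $Z_k=1$ if $\mathbb E[u^*(W_k)]+\varepsilon_{k,1}\ge\mathbb E[u^*(Y_k)]+\varepsilon_{k,2}$ and $Z_k=-1$ otherwise (equivalently, the $Z_k$ are independent logit responses). Let $\alpha^*_j=u^*(y_j)$. Estimator: given $Z=(Z_1,\dots,Z_K)$, let $(\bar\alpha,\bar\beta,\gamma)\in\mathbb R^N\times\mathbb R^{N-1}\times[0,\bar c]$ be any maximizer of $-\sum_{k=1}^K\log\bigl[1+\exp(-\sum_{j=1}^N Z_kp^k_j\bar\alpha_j)\bigr]$ subject to $\bar\beta_j=(\bar\alpha_{j+1}-\bar\alpha_j)/(y_{j+1}-y_j)$, $\bar\beta_{j+1}\le\bar\beta_j$, $\bar\beta_1\le L\gamma$, $\bar\beta_{N-1}\ge0$, $\bar\alpha_1=0$, $\bar\alpha_N=\gamma$; such maximizers exist. Put $\hat\alpha^{\rm MLE}=\bar\alpha/\gamma$ and $\hat\sigma_{\rm MLE}=1/\gamma$; if $\gamma=0$, then $\bar\alpha=0$, $\hat\sigma_{\rm MLE}=+\infty$, and $\hat\alpha^{\rm MLE}/\hat\sigma_{\rm MLE}$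 is read as $0$. Theorem. For all $\lambda>0$ and $\delta\in(0,1)$, with probability at least $1-\delta$ every such estimate satisfies $$\left\|\frac{\hat\alpha^{\rm MLE}}{\hat\sigma_{\rm MLE}}-\frac{\alpha^*}{\sigma^*}\right\|_{Q^\top(\Sigma_D+\lambda\mathbf I)Q}\le\sqrt{\frac{R_D+2\sqrt{-R_D\log\delta}-2\log\delta}{\omega^2K}}+\sqrt{\frac{R_D+2\sqrt{-R_D\log\delta}-2\log\delta}{\omega^2K}+\lambda\bigl(\bar c\sqrt{N-1}\bigr)^2},$$ where $\|x\|_A=\sqrt{x^\top Ax}$. On the same event, the same bound holds with $\hat\alpha^{\rm MLE}_j=\hat u(y_j)$, $\hat\sigma_{\rm MLE}=\hat\sigma$ for every maximizer $(\hat u,\hat\sigma)$ of the log-likelihood over $u\in\mathcal U_c$ and $\sigma\in[1/\bar c,\infty)$, i.e. of $\sum_k\log q_k(u,\sigma)$, where $q_k(u,\sigma)=\frac{e^{\mathbb E[u(W_k)]/\sigma}}{e^{\mathbb E[u(W_k)]/\sigma}+e^{\mathbb E[u(Y_k)]/\sigma}}$ if $Z_k=1$ and $q_k(u,\sigma)=\frac{e^{\mathbb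 E[u(Y_k)]/\sigma}}{e^{\mathbb E[u(W_k)]/\sigma}+e^{\mathbb E[u(Y_k)]/\sigma}}$ if $Z_k=-1$. -/

import Mathlib

open MeasureTheory ProbabilityTheory
open scoped Matrix ENNReal

noncomputable section

namespace VNM

/-- The admissible utility functions on `[0, b]`: increasing, concave, Lipschitz with modulus at
most `L`, normalized by `u 0 = 0` and `u b = 1`.  Only the values of `u` on `[0, b]` matter. -/
def utilitySet (b L : ℝ) : Set (ℝ → ℝ) :=
  {u | MonotoneOn u (Set.Icc 0 b) ∧ ConcaveOn ℝ (Set.Icc 0 b) u ∧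
    LipschitzOnWith (Real.toNNReal L) u (Set.Icc 0 b) ∧ u 0 = 0 ∧ u b = 1}

/-- A lottery: a discrete payoff distribution with finite support contained in `[0, b]`. -/
structure Lottery (b : ℝ) where
  law : PMF ℝ
  finite_support : law.support.Finite
  support_subset : law.support ⊆ Set.Icc 0 b

/-- The probability that the lottery pays `y`. -/
def Lottery.prob {b : ℝ} (X : Lottery b) (y : ℝ) : ℝ := (X.law y).toReal

/-- The support of a lottery as a finite set. -/
def Lottery.supp {b : ℝ} (X : Lottery b) : Finset ℝ := X.finite_support.toFinset

/-- The expected utility `𝔼[u(X)]` of a lottery. -/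
def Lottery.expect {b : ℝ} (X : Lottery b) (u : ℝ → ℝ) : ℝ := ∑ y ∈ X.supp, X.prob y * u y

/-- The Gumbel distribution with location `0` and scale `σ`, through its density
`σ⁻¹ exp(-x/σ) exp(-exp(-x/σ))`. -/
def gumbelMeasure (σ : ℝ) : Measure ℝ :=
  volume.withDensity fun x =>
    ENNReal.ofReal (1 / σ * Real.exp (-x / σ) * Real.exp (-Real.exp (-x / σ)))

section Queries

variable {b : ℝ} {K : ℕ} (W Y : Fin K → Lottery b)

/-- The response to query `k`, for utility function `u` and realized errors `eW` (added to the
expected utility of the first lottery) and `eY` (second lottery): `1` if the first lottery is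
chosen, `-1` otherwise. -/
def response (u : ℝ → ℝ) (eW eY : Fin K → ℝ) (k : Fin K) : ℝ :=
  if (Y k).expect u + eY k ≤ (W k).expect u + eW k then 1 else -1

/-- The logit probability of the response `z` to query `k`, given `u` and `σ`. -/
def responseProb (u : ℝ → ℝ) (σ : ℝ) (k : Fin K) (z : ℝ) : ℝ :=
  (if z = 1 then Real.exp ((W k).expect u / σ) else Real.exp ((Y k).expect u / σ)) /
    (Real.exp ((W k).expect u / σ) + Real.exp ((Y k).expect u / σ))

/-- The log-likelihood of `(u, σ)` given the responses `z`. -/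
def logLikelihood (z : Fin K → ℝ) (u : ℝ → ℝ) (σ : ℝ) : ℝ :=
  ∑ k, Real.log (responseProb W Y u σ k (z k))

/-- `(u, σ)` maximizes the log-likelihood over all admissible utility functions and all finite
scales `σ ≥ 1 / c`. -/
def IsMLE (L c : ℝ) (z : Fin K → ℝ) (u : ℝ → ℝ) (σ : ℝ) : Prop :=
  u ∈ utilitySet b L ∧ 1 / c ≤ σ ∧
    ∀ v ∈ utilitySet b L, ∀ τ : ℝ, 1 / c ≤ τ →
      logLikelihood W Y z v τ ≤ logLikelihood W Y z u σ

/-- The set of breakpoints: `0`, `b`, and all payoffs in the supports of the lotteries. -/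
def breakpoints : Finset ℝ :=
  {0} ∪ (Finset.univ.biUnion fun k => (W k).supp) ∪
    (Finset.univ.biUnion fun k => (Y k).supp) ∪ {b}

/-- The number `N` of breakpoints. -/
def numPts : ℕ := (breakpoints W Y).card

/-- The breakpoints in increasing order; `pt W Y j` is the breakpoint with (one-based) number
`j + 1`. -/
def pt (j : Fin (numPts W Y)) : ℝ := (breakpoints W Y).orderEmbOfFin rfl j

/-- The left end of the `i`-th interval between consecutive breakpoints, as an index. -/
def leftIdx (i : Fin (numPts W Y - 1)) : Fin (numPts W Y) := ⟨i.1, by omega⟩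

/-- The right end of the `i`-th interval between consecutive breakpoints, as an index. -/
def rightIdx (i : Fin (numPts W Y - 1)) : Fin (numPts W Y) := ⟨i.1 + 1, by omega⟩

/-- The probability-mass difference vector of query `k`. -/
def massDiff (k : Fin K) (j : Fin (numPts W Y)) : ℝ :=
  (W k).prob (pt W Y j) - (Y k).prob (pt W Y j)

/-- The `K × (N - 1)` matrix of mass differences at all breakpoints but the first. -/
def reducedMatrix : Matrix (Fin K) (Fin (numPts W Y - 1)) ℝ :=
  Matrix.of fun k i => massDiff W Y k (rightIdx W Y i)

/-- The empirical information matrix `(1 / K) Pᵀ P`. -/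
def infoMatrix : Matrix (Fin (numPts W Y - 1)) (Fin (numPts W Y - 1)) ℝ :=
  (1 / (K : ℝ)) • ((reducedMatrix W Y)ᵀ * reducedMatrix W Y)

/-- The `(N - 1) × N` matrix `[0, I]` that drops the first coordinate. -/
def dropFirst : Matrix (Fin (numPts W Y - 1)) (Fin (numPts W Y)) ℝ :=
  Matrix.of fun i j => if j = rightIdx W Y i then 1 else 0

/-- The weight matrix `Qᵀ (Σ + lam I) Q`. -/
def weightMatrix (lam : ℝ) : Matrix (Fin (numPts W Y)) (Fin (numPts W Y)) ℝ :=
  (dropFirst W Y)ᵀ * (infoMatrix W Y + lam • 1) * dropFirst W Y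

/-- The vector of values of `u / σ` at the breakpoints. -/
def adjustedValues (u : ℝ → ℝ) (σ : ℝ) (j : Fin (numPts W Y)) : ℝ := u (pt W Y j) / σ

/-- The objective of the convex program for the maximum likelihood estimate. -/
def programObjective (z : Fin K → ℝ) (α : Fin (numPts W Y) → ℝ) : ℝ :=
  -∑ k, Real.log (1 + Real.exp (∑ j, -z k * massDiff W Y k j * α j))

/-- Feasibility of `(α, β, γ)` for the convex program: `α` holds the adjusted utility values at the
breakpoints, `β` the slopes between them, and `γ` stands for `1 / σ`, where `γ = 0` means
`σ = ∞`. -/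
structure ProgramFeasible (L c : ℝ) (α : Fin (numPts W Y) → ℝ)
    (β : Fin (numPts W Y - 1) → ℝ) (γ : ℝ) : Prop where
  slope : ∀ i, β i = (α (rightIdx W Y i) - α (leftIdx W Y i)) /
    (pt W Y (rightIdx W Y i) - pt W Y (leftIdx W Y i))
  concave : ∀ i i' : Fin (numPts W Y - 1), i'.1 = i.1 + 1 → β i' ≤ β i
  lipschitz : ∀ i, i.1 = 0 → β i ≤ L * γ
  monotone : ∀ i, i.1 + 1 = numPts W Y - 1 → 0 ≤ β i
  first : ∀ j, j.1 = 0 → α j = 0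
  last : ∀ j, j.1 + 1 = numPts W Y → α j = γ
  range : γ ∈ Set.Icc 0 c

/-- `(α, β, γ)` is an optimal solution of the convex program given the responses `z`. -/
def IsProgramOptimal (L c : ℝ) (z : Fin K → ℝ) (α : Fin (numPts W Y) → ℝ)
    (β : Fin (numPts W Y - 1) → ℝ) (γ : ℝ) : Prop :=
  ProgramFeasible W Y L c α β γ ∧
    ∀ α' β' γ', ProgramFeasible W Y L c α' β' γ' →
      programObjective W Y z α' ≤ programObjective W Y z α

end Queries

/-- The estimated scale `1 / γ`, which is `∞` when `γ = 0`. -/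
def sigmaHat (γ : ℝ) : ℝ≥0∞ := (ENNReal.ofReal γ)⁻¹

/-- The estimated utility values `α / γ` at the breakpoints. -/
def alphaHat {n : ℕ} (α : Fin n → ℝ) (γ : ℝ) : Fin n → ℝ := fun j => α j / γ

/-- The vector `α / σ` for a scale `σ ∈ (0, ∞]`; it is `0` when `σ = ∞`. -/
def adjusted {n : ℕ} (α : Fin n → ℝ) (σ : ℝ≥0∞) : Fin n → ℝ := fun j => α j * (σ⁻¹).toReal

/-- The weighted (semi)norm `√(xᵀ A x)` for a positive semidefinite `A`. -/
def weightedNorm {n : ℕ} (A : Matrix (Fin n) (Fin n) ℝ) (x : Fin n → ℝ) : ℝ :=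
  Real.sqrt (x ⬝ᵥ (A *ᵥ x))

/-- The constant `ω = 1 / (2 + 2 exp(2 c))`. -/
def omegaConst (c : ℝ) : ℝ := 1 / (2 + 2 * Real.exp (2 * c))

/-- `(R + 2 √(-R log δ) - 2 log δ) / (ω² K)`. -/
def devTerm (R K : ℕ) (c δ : ℝ) : ℝ :=
  ((R : ℝ) + 2 * Real.sqrt (-(R : ℝ) * Real.log δ) - 2 * Real.log δ) /
    (omegaConst c ^ 2 * (K : ℝ))

/-- The right-hand side `√d + √(d + lam (c √(N - 1))²)` of the error estimate, where
`d = devTerm R K c δ`. -/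
def errorBound (R K N : ℕ) (c lam δ : ℝ) : ℝ :=
  Real.sqrt (devTerm R K c δ) +
    Real.sqrt (devTerm R K c δ + lam * (c * Real.sqrt ((N : ℝ) - 1)) ^ 2)

end VNM

end

/-! ### Tail bound for a projected sub-Gaussian vector -/

section QuadraticTail

/-! Write `x` for the difference between estimated and true adjusted utilities at the breakpoints,
`w k` for its pairing with the mass differences of query `k`, and `v k` for the score of query `k`
at the truth. Utility differences lie in `[-c, c]`, where the logistic loss has second derivative at
least `ω = omegaConst c`. Since the estimate has at least the likelihood of the truth, this strong
convexity yields `ω/2 * ‖w‖² ≤ ⟨v, w⟩` (`sum_sq_error_le`).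

The vector `w` lies in the column space of the reduced matrix, of dimension `R`, so only the
projection of `v` onto that space matters, and `‖w‖² ≤ 4 ‖proj v‖² / ω²`
(`sum_sq_le_of_quadratic_le`). A difference of Gumbel errors is logistic, so the scores are
independent centred two-valued variables of range one. Hence they are sub-Gaussian with proxy `1/4`,
and `‖proj v‖² ≤ R - 2 log δ` outside an event of probability at most `δ` (`measure_sum_sq_gt_le`).

The ridge part of the norm is deterministic: the entries of `x` lie in `[-c, c]` and the first one
vanishes. The argument uses the estimator only through its range and its comparison with the truth,
so one event serves both the convex program and the direct likelihood maximizer. -/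

theorem gaussianReal_exp_sq_div_four :
    Integrable (fun g : ℝ => Real.exp (g ^ 2 / 4)) (gaussianReal 0 1) ∧
      ∫ g, Real.exp (g ^ 2 / 4) ∂(gaussianReal 0 1) = Real.sqrt 2 := by
  -- The tilt turns the density into an unnormalized Gaussian of variance 2, of mass `√(4π) / √(2π)
  -- = √2`.
  have hfun : (fun g : ℝ => gaussianPDFReal 0 1 g * Real.exp (g ^ 2 / 4)) =
      fun g => (Real.sqrt (2 * Real.pi))⁻¹ * Real.exp (-(1 / 4) * g ^ 2) := by
    funext g
    rw [gaussianPDFReal, mul_assoc, ← Real.exp_add]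
    congr 2
    · norm_num
    · norm_num
      ring
  constructor
  · rw [gaussianReal_of_var_ne_zero _ one_ne_zero, gaussianPDF_def,
      integrable_withDensity_iff_integrable_smul₀' (by fun_prop) (by simp)]
    simp only [ENNReal.toReal_ofReal (gaussianPDFReal_nonneg 0 1 _), smul_eq_mul, hfun]
    exact (integrable_exp_neg_mul_sq (by norm_num)).const_mul _
  · rw [integral_gaussianReal_eq_integral_smul one_ne_zero]
    simp only [smul_eq_mul, hfun]
    rw [integral_const_mul, integral_gaussian, ← Real.sqrt_inv,
      ← Real.sqrt_mul (by positivity)]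
    congr 1
    have := Real.pi_pos
    field_simp
    norm_num

theorem gaussianReal_exp_mul (a : ℝ) :
    Integrable (fun g : ℝ => Real.exp (a * g)) (gaussianReal 0 1) ∧
      ∫ g, Real.exp (a * g) ∂(gaussianReal 0 1) = Real.exp (a ^ 2 / 2) := by
  refine ⟨integrable_exp_mul_gaussianReal a, ?_⟩
  have := mgf_gaussianReal (p := gaussianReal 0 1) (X := id) (μ := 0) (v := 1) (by simp) a
  simpa [mgf] using this

theorem lintegral_exp_sum_pi_gaussian {ι : Type*} [Fintype ι] (h : ι → ℝ → ℝ)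
    (hint : ∀ i, Integrable (fun g => Real.exp (h i g)) (gaussianReal 0 1)) :
    ∫⁻ g, ENNReal.ofReal (Real.exp (∑ i, h i (g i))) ∂(Measure.pi fun _ : ι => gaussianReal 0 1) =
      ENNReal.ofReal (∏ i, ∫ g, Real.exp (h i g) ∂(gaussianReal 0 1)) := by
  simp only [Real.exp_sum]
  rw [← ofReal_integral_eq_lintegral_ofReal (Integrable.fintype_prod hint)
    (Filter.Eventually.of_forall fun g => Finset.prod_nonneg fun i _ => (Real.exp_pos _).le),
    integral_fintype_prod_eq_prod (fun i x => Real.exp (h i x))]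

variable {Ω : Type*} [MeasurableSpace Ω] {μ : Measure Ω} [IsProbabilityMeasure μ]
  {ι κ : Type*} [Fintype ι] [DecidableEq ι] [Fintype κ]

/-- Gaussian linearization: `exp (s²) = 𝔼 exp (√2 s g)` for standard normal `g`. After exchanging
the two expectations, the exponent is linear in the independent `v k`, so the sub-Gaussian bound
applies for each fixed `g`; a Gaussian integral remains. -/
theorem lintegral_exp_sum_sq_le (v : κ → Ω → ℝ) (hv : iIndepFun v μ)
    (hsub : ∀ k, HasSubgaussianMGF (v k) (1 / 4) μ) (e : ι → κ → ℝ)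
    (he : ∀ i j, ∑ k, e i k * e j k = if i = j then 1 else 0) :
    ∫⁻ ω, ENNReal.ofReal (Real.exp (∑ i, (∑ k, e i k * v k ω) ^ 2)) ∂μ ≤
      ENNReal.ofReal (Real.sqrt 2 ^ Fintype.card ι) := by
  have hmeas : ∀ k, AEMeasurable (v k) μ := fun k => (hsub k).aemeasurable
  have hgauss : ∀ ω, ENNReal.ofReal (Real.exp (∑ i, (∑ k, e i k * v k ω) ^ 2)) =
      ∫⁻ g, ENNReal.ofReal (Real.exp (∑ i, (Real.sqrt 2 * ∑ k, e i k * v k ω) * g i))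
        ∂(Measure.pi fun _ : ι => gaussianReal 0 1) := by
    intro ω
    rw [lintegral_exp_sum_pi_gaussian (fun i g => (Real.sqrt 2 * ∑ k, e i k * v k ω) * g)
      fun i => (gaussianReal_exp_mul _).1]
    simp only [(gaussianReal_exp_mul _).2, Real.exp_sum, mul_pow]
    norm_num
  have hinner : ∀ g : ι → ℝ,
      ∫⁻ ω, ENNReal.ofReal (Real.exp (∑ i, (Real.sqrt 2 * ∑ k, e i k * v k ω) * g i)) ∂μ ≤
        ENNReal.ofReal (Real.exp (∑ i, g i ^ 2 / 4)) := by
    intro g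
    set a : κ → ℝ := fun k => Real.sqrt 2 * ∑ i, g i * e i k with ha
    have hlin : ∀ ω, ∑ i, (Real.sqrt 2 * ∑ k, e i k * v k ω) * g i = ∑ k, a k * v k ω := by
      intro ω
      simp only [ha, Finset.mul_sum, Finset.sum_mul]
      rw [Finset.sum_comm]
      exact Finset.sum_congr rfl fun k _ => Finset.sum_congr rfl fun i _ => by ring
    -- Orthonormality of the `e i`. With proxy `1/4`, the moment bound becomes `exp (‖a‖² / 8) = exp
    -- (‖g‖² / 4)`.
    have hsq : ∑ k, a k ^ 2 = 2 * ∑ i, g i ^ 2 := by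
      have h1 : ∀ k, a k ^ 2 = 2 * ∑ i, ∑ j, g i * g j * (e i k * e j k) := by
        intro k
        simp only [ha, mul_pow, Real.sq_sqrt zero_le_two]
        rw [sq (∑ i, _), Finset.sum_mul_sum]
        congr 1
        exact Finset.sum_congr rfl fun i _ => Finset.sum_congr rfl fun j _ => by ring
      simp only [h1]
      rw [← Finset.mul_sum, Finset.sum_comm]
      congr 1
      refine Finset.sum_congr rfl fun i _ => ?_
      rw [Finset.sum_comm]
      simp only [← Finset.mul_sum, he]
      simp [sq]
    have hS := HasSubgaussianMGF.sum_of_iIndepFun (s := Finset.univ)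
      (X := fun k ω => a k * v k ω)
      (hv.comp (fun k x => a k * x) fun k => measurable_const_mul _)
      (c := fun k => Real.toNNReal (a k ^ 2) * (1 / 4))
      (fun k _ => by
        rw [Real.toNNReal_of_nonneg (sq_nonneg _)]
        exact (hsub k).const_mul (a k))
    simp only [hlin]
    have hint := hS.integrable_exp_mul 1
    have hle := hS.mgf_le 1
    simp only [one_mul, mgf] at hint hle
    rw [← ofReal_integral_eq_lintegral_ofReal hint
      (Filter.Eventually.of_forall fun _ => (Real.exp_pos _).le)]
    refine ENNReal.ofReal_le_ofReal (hle.trans (le_of_eq ?_))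
    congr 1
    push_cast
    simp only [Real.coe_toNNReal _ (sq_nonneg _)]
    rw [← Finset.sum_div, ← Finset.sum_mul, hsq]
    ring
  calc ∫⁻ ω, ENNReal.ofReal (Real.exp (∑ i, (∑ k, e i k * v k ω) ^ 2)) ∂μ
      = ∫⁻ ω, ∫⁻ g, ENNReal.ofReal (Real.exp (∑ i, (Real.sqrt 2 * ∑ k, e i k * v k ω) * g i))
        ∂(Measure.pi fun _ : ι => gaussianReal 0 1) ∂μ := by simp only [hgauss]
    _ = ∫⁻ g, ∫⁻ ω, ENNReal.ofReal (Real.exp (∑ i, (Real.sqrt 2 * ∑ k, e i k * v k ω) * g i))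
        ∂μ ∂(Measure.pi fun _ : ι => gaussianReal 0 1) := by
      refine lintegral_lintegral_swap ?_
      have h1 : ∀ k, AEMeasurable (fun p : Ω × (ι → ℝ) => v k p.1)
          (μ.prod (Measure.pi fun _ : ι => gaussianReal 0 1)) := fun k => (hmeas k).comp_fst
      have h2 : ∀ i, AEMeasurable (fun p : Ω × (ι → ℝ) => p.2 i)
          (μ.prod (Measure.pi fun _ : ι => gaussianReal 0 1)) := fun i =>
        ((measurable_pi_apply i).comp measurable_snd).aemeasurable
      refine (Real.measurable_exp.comp_aemeasurable ?_).ennreal_ofReal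
      refine Finset.aemeasurable_fun_sum _ fun i _ => ((?_ : AEMeasurable _ _).const_mul _).mul (h2 i)
      exact Finset.aemeasurable_fun_sum _ fun k _ => (h1 k).const_mul _
    _ ≤ ∫⁻ g, ENNReal.ofReal (Real.exp (∑ i, g i ^ 2 / 4))
        ∂(Measure.pi fun _ : ι => gaussianReal 0 1) := lintegral_mono hinner
    _ = ENNReal.ofReal (Real.sqrt 2 ^ Fintype.card ι) := by
      rw [lintegral_exp_sum_pi_gaussian (fun _ g => g ^ 2 / 4)
        fun _ => gaussianReal_exp_sq_div_four.1]
      simp [gaussianReal_exp_sq_div_four.2]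

theorem measure_sum_sq_gt_le (v : κ → Ω → ℝ) (hv : iIndepFun v μ)
    (hsub : ∀ k, HasSubgaussianMGF (v k) (1 / 4) μ) (e : ι → κ → ℝ)
    (he : ∀ i j, ∑ k, e i k * e j k = if i = j then 1 else 0) {t : ℝ} (ht : 0 ≤ t) :
    μ {ω | Fintype.card ι + 2 * t < ∑ i, (∑ k, e i k * v k ω) ^ 2} ≤
      ENNReal.ofReal (Real.exp (-t)) := by
  have hmeas : ∀ k, AEMeasurable (v k) μ := fun k => (hsub k).aemeasurable
  set r : ℝ := Fintype.card ι + 2 * t with hr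
  have hmarkov := mul_meas_ge_le_lintegral₀ (μ := μ)
    (f := fun ω => ENNReal.ofReal (Real.exp (∑ i, (∑ k, e i k * v k ω) ^ 2)))
    (by
      refine (Real.measurable_exp.comp_aemeasurable ?_).ennreal_ofReal
      refine Finset.aemeasurable_fun_sum _ fun i _ => AEMeasurable.pow_const ?_ 2
      exact Finset.aemeasurable_fun_sum _ fun k _ => (hmeas k).const_mul _)
    (ENNReal.ofReal (Real.exp r))
  have hsubset : μ {ω | r < ∑ i, (∑ k, e i k * v k ω) ^ 2} ≤
      μ {ω | ENNReal.ofReal (Real.exp r) ≤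
        ENNReal.ofReal (Real.exp (∑ i, (∑ k, e i k * v k ω) ^ 2))} :=
    measure_mono fun ω hω => ENNReal.ofReal_le_ofReal (Real.exp_le_exp.2 (le_of_lt hω))
  have h1 := (mul_le_mul_right hsubset (ENNReal.ofReal (Real.exp r))).trans
    (hmarkov.trans (lintegral_exp_sum_sq_le v hv hsub e he))
  -- The dimension term in the threshold `r` pays for this prefactor in Markov's inequality, since
  -- `√2 ≤ 2 ≤ e`.
  have hs : Real.sqrt 2 ^ Fintype.card ι ≤ Real.exp (Fintype.card ι) := by
    rw [← Real.exp_one_pow]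
    refine pow_le_pow_left₀ (Real.sqrt_nonneg _) ?_ _
    have h2 : Real.sqrt 2 ≤ 2 := by
      rw [Real.sqrt_le_left (by norm_num)]; norm_num
    linarith [Real.add_one_le_exp 1]
  have hfin : Real.sqrt 2 ^ Fintype.card ι ≤ Real.exp r * Real.exp (-t) := by
    rw [← Real.exp_add]
    exact hs.trans (Real.exp_le_exp.2 (by rw [hr]; linarith))
  have h3 := h1.trans (ENNReal.ofReal_le_ofReal hfin)
  rw [ENNReal.ofReal_mul (Real.exp_pos _).le] at h3
  exact (ENNReal.mul_le_mul_iff_right (by simpa using Real.exp_pos r) (by simp)).1 h3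

end QuadraticTail

/-! ### Gumbel errors and the logit choice probability -/

section Gumbel

open Filter Topology

theorem hasDerivAt_gumbel_antideriv {σ A : ℝ} (hA : 0 < A) (x : ℝ) :
    HasDerivAt (fun x => Real.exp (-A * Real.exp (-x / σ)) / A)
      (1 / σ * Real.exp (-x / σ) * Real.exp (-A * Real.exp (-x / σ))) x := by
  have h1 : HasDerivAt (fun x : ℝ => -x / σ) (-1 / σ) x := (hasDerivAt_id x).neg.div_const σ
  have h2 := ((h1.exp.const_mul (-A)).exp).div_const A
  convert! h2 using 1
  field_simp

theorem gumbel_antideriv_tendsto_atTop {σ A : ℝ} (hσ : 0 < σ) :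
    Tendsto (fun x => Real.exp (-A * Real.exp (-x / σ)) / A) atTop (𝓝 (1 / A)) := by
  have h1 : Tendsto (fun x : ℝ => -x / σ) atTop atBot :=
    tendsto_neg_atTop_atBot.atBot_div_const hσ
  have h2 := (((Real.tendsto_exp_atBot.comp h1).const_mul (-A)).rexp).div_const A
  simpa using h2

theorem gumbel_antideriv_tendsto_atBot {σ A : ℝ} (hσ : 0 < σ) (hA : 0 < A) :
    Tendsto (fun x => Real.exp (-A * Real.exp (-x / σ)) / A) atBot (𝓝 0) := by
  have h1 : Tendsto (fun x : ℝ => -x / σ) atBot atTop :=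
    tendsto_neg_atBot_atTop.atTop_div_const hσ
  have h2 : Tendsto (fun x => -A * Real.exp (-x / σ)) atBot atBot :=
    (Real.tendsto_exp_atTop.comp h1).const_mul_atTop_of_neg (by linarith)
  have h3 := (Real.tendsto_exp_atBot.comp h2).div_const A
  simpa using h3

/-- The integrand is positive and its antiderivative takes values in `[0, 1 / A]`, so the integrals
over `[-i, i]` stay bounded. -/
theorem integrable_gumbel_integrand {σ A : ℝ} (hσ : 0 < σ) (hA : 0 < A) :
    Integrable fun x : ℝ => 1 / σ * Real.exp (-x / σ) * Real.exp (-A * Real.exp (-x / σ)) := by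
  have hcont : Continuous fun x : ℝ =>
      1 / σ * Real.exp (-x / σ) * Real.exp (-A * Real.exp (-x / σ)) := by fun_prop
  refine integrable_of_intervalIntegral_norm_bounded (1 / A)
    (a := fun i : ℝ => -i) (b := fun i : ℝ => i) (l := atTop)
    (fun i => (hcont.integrableOn_Icc.mono_set Set.Ioc_subset_Icc_self))
    tendsto_neg_atTop_atBot tendsto_id (Eventually.of_forall fun i => ?_)
  have hnorm : ∀ x : ℝ, ‖1 / σ * Real.exp (-x / σ) * Real.exp (-A * Real.exp (-x / σ))‖ =
      1 / σ * Real.exp (-x / σ) * Real.exp (-A * Real.exp (-x / σ)) := fun x =>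
    Real.norm_of_nonneg (by positivity)
  simp only [hnorm]
  rw [intervalIntegral.integral_eq_sub_of_hasDerivAt
    (fun x _ => hasDerivAt_gumbel_antideriv (σ := σ) hA x) (hcont.intervalIntegrable _ _)]
  have h1 : 0 ≤ Real.exp (-A * Real.exp (- -i / σ)) / A := by positivity
  have h2 : Real.exp (-A * Real.exp (-i / σ)) / A ≤ 1 / A := by
    gcongr
    rw [Real.exp_le_one_iff]
    have := Real.exp_pos (-i / σ)
    nlinarith
  linarith

theorem lintegral_gumbel_integrand {σ A : ℝ} (hσ : 0 < σ) (hA : 0 < A) :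
    ∫⁻ x : ℝ, ENNReal.ofReal
      (1 / σ * Real.exp (-x / σ) * Real.exp (-A * Real.exp (-x / σ))) =
        ENNReal.ofReal (1 / A) := by
  rw [← ofReal_integral_eq_lintegral_ofReal (integrable_gumbel_integrand hσ hA)
    (Eventually.of_forall fun x => by positivity),
    integral_of_hasDerivAt_of_tendsto (hasDerivAt_gumbel_antideriv hA)
      (integrable_gumbel_integrand hσ hA) (gumbel_antideriv_tendsto_atBot hσ hA)
      (gumbel_antideriv_tendsto_atTop hσ), sub_zero]

theorem gumbelMeasure_Iic {σ : ℝ} (hσ : 0 < σ) (x : ℝ) :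
    VNM.gumbelMeasure σ (Set.Iic x) = ENNReal.ofReal (Real.exp (-Real.exp (-x / σ))) := by
  have hint := integrable_gumbel_integrand hσ one_pos
  rw [VNM.gumbelMeasure, withDensity_apply _ measurableSet_Iic]
  simp only [← neg_one_mul (Real.exp (-_ / σ))]
  rw [← ofReal_integral_eq_lintegral_ofReal hint.integrableOn
    (Eventually.of_forall fun x => by positivity),
    integral_Iic_of_hasDerivAt_of_tendsto' (fun x _ => hasDerivAt_gumbel_antideriv one_pos x)
      hint.integrableOn (gumbel_antideriv_tendsto_atBot hσ one_pos)]
  simp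

/-- Given the first error `x`, the distribution function at `x + d` multiplies the density by a
factor of the same double-exponential form. The product is again a Gumbel integrand, with `A = 1 +
exp (-d / σ)`. -/
theorem gumbelMeasure_prod_le {σ : ℝ} (hσ : 0 < σ) [SFinite (VNM.gumbelMeasure σ)] (d : ℝ) :
    ((VNM.gumbelMeasure σ).prod (VNM.gumbelMeasure σ)) {p : ℝ × ℝ | p.2 ≤ p.1 + d} =
      ENNReal.ofReal (1 / (1 + Real.exp (-d / σ))) := by
  rw [Measure.prod_apply (measurableSet_le (by fun_prop) (by fun_prop))]
  have h1 : ∀ x : ℝ, VNM.gumbelMeasure σ (Prod.mk x ⁻¹' {p : ℝ × ℝ | p.2 ≤ p.1 + d}) =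
      ENNReal.ofReal (Real.exp (-Real.exp (-(x + d) / σ))) := fun x =>
    gumbelMeasure_Iic hσ (x + d)
  simp only [h1]
  rw [← lintegral_gumbel_integrand (A := 1 + Real.exp (-d / σ)) hσ (by positivity),
    VNM.gumbelMeasure, lintegral_withDensity_eq_lintegral_mul _ (by fun_prop) (by fun_prop)]
  refine lintegral_congr fun x => ?_
  rw [Pi.mul_apply, ← ENNReal.ofReal_mul (by positivity), mul_assoc (_ * _), ← Real.exp_add]
  congr 3
  rw [show -(x + d) / σ = -x / σ + -d / σ by ring, Real.exp_add]
  ring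

end Gumbel

/-! ### Independence of error pairs and Hoeffding's lemma -/

section Independence

variable {Ω : Type*} [MeasurableSpace Ω] {μ : Measure Ω} [IsProbabilityMeasure μ]

/-- Independence is read as a product joint law; regrouping the coordinates of a product measure
into pairs preserves it. -/
theorem iIndepFun_prodMk_of_sumElim {κ : Type*} [Fintype κ] {X Y : κ → Ω → ℝ}
    (hX : ∀ k, AEMeasurable (X k) μ) (hY : ∀ k, AEMeasurable (Y k) μ)
    (h : iIndepFun (Sum.elim X Y) μ) :
    iIndepFun (fun k ω => (X k ω, Y k ω)) μ := by
  have hpX : ∀ k, IsProbabilityMeasure (μ.map (X k)) := fun k =>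
    Measure.isProbabilityMeasure_map (hX k)
  have hpY : ∀ k, IsProbabilityMeasure (μ.map (Y k)) := fun k =>
    Measure.isProbabilityMeasure_map (hY k)
  have hm : ∀ i, AEMeasurable (Sum.elim X Y i) μ := by
    rintro (k | k)
    exacts [hX k, hY k]
  have hpS : ∀ i, IsProbabilityMeasure (μ.map (Sum.elim X Y i)) := fun i =>
    Measure.isProbabilityMeasure_map (hm i)
  have hpair : ∀ k, μ.map (fun ω => (X k ω, Y k ω)) = (μ.map (X k)).prod (μ.map (Y k)) := fun k =>
    (h.indepFun (i := Sum.inl k) (j := Sum.inr k) (by simp)).map_prod_eq_prod_map_map (hX k) (hY k)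
  rw [iIndepFun_iff_map_fun_eq_pi_map fun k => (hX k).prodMk (hY k)]
  simp only [hpair]
  have hmap := (measurePreserving_sumPiEquivProdPi fun i => μ.map (Sum.elim X Y i)).map_eq
  rw [← h.map_fun_eq_pi_map hm,
    AEMeasurable.map_map_of_aemeasurable (by fun_prop) (aemeasurable_pi_lambda _ hm)] at hmap
  rw [← (MeasurableEquiv.arrowProdEquivProdArrow ℝ ℝ κ).map_measurableEquiv_injective.eq_iff,
    (measurePreserving_arrowProdEquivProdArrow ℝ ℝ κ _ _).map_eq,
    AEMeasurable.map_map_of_aemeasurable (by fun_prop)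
      (aemeasurable_pi_lambda _ fun k => (hX k).prodMk (hY k))]
  exact hmap

/-- Hoeffding's lemma for a centred indicator: range one gives proxy `(1/2)² = 1/4`. -/
theorem hasSubgaussianMGF_ite {s : Set Ω} (hs : NullMeasurableSet s μ) [DecidablePred (· ∈ s)]
    {p : ℝ} (hp : μ.real s = p) :
    HasSubgaussianMGF (fun ω => if ω ∈ s then 1 - p else -p) (1 / 4) μ := by
  have hfun : (fun ω => if ω ∈ s then 1 - p else -p) =
      fun ω => s.indicator (fun _ => (1 : ℝ)) ω - p := by
    funext ω
    by_cases h : ω ∈ s <;> simp [h]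
  have hm : AEMeasurable (s.indicator fun _ => (1 : ℝ)) μ :=
    aemeasurable_const.indicator₀ hs
  have hint : ∫ ω, s.indicator (fun _ => (1 : ℝ)) ω ∂μ = p := by
    rw [integral_indicator₀ hs]
    simp [hp]
  have hsub := hasSubgaussianMGF_of_mem_Icc (a := 0) (b := 1) hm
    (Filter.Eventually.of_forall fun ω => by
      by_cases h : ω ∈ s <;> simp [h])
  rw [hint, ← hfun] at hsub
  convert hsub using 1
  ext
  norm_num

end Independence

/-! ### Strong convexity of the logistic loss -/

section Logistic

theorem hasDerivAt_log_one_add_exp_neg (x : ℝ) :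
    HasDerivAt (fun x => Real.log (1 + Real.exp (-x))) (-(1 / (1 + Real.exp x))) x := by
  have h1 : HasDerivAt (fun x : ℝ => 1 + Real.exp (-x)) (Real.exp (-x) * -1) x :=
    ((hasDerivAt_neg x).exp).const_add 1
  convert! h1.log (by positivity) using 1
  have := Real.exp_pos x
  rw [Real.exp_neg]
  field_simp
  ring

theorem hasDerivAt_neg_inv_one_add_exp (x : ℝ) :
    HasDerivAt (fun x => -(1 / (1 + Real.exp x))) (Real.exp x / (1 + Real.exp x) ^ 2) x := by
  have h1 : HasDerivAt (fun x : ℝ => 1 + Real.exp x) (Real.exp x) x :=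
    (Real.hasDerivAt_exp x).const_add 1
  have h2 := (h1.inv (by positivity)).neg
  simp only [one_div]
  convert! h2 using 1
  ring

theorem omegaConst_le_logistic_deriv {c x : ℝ} (hx : |x| ≤ c) :
    VNM.omegaConst c ≤ Real.exp x / (1 + Real.exp x) ^ 2 := by
  obtain ⟨h1, h2⟩ := abs_le.1 hx
  rw [VNM.omegaConst, div_le_div_iff₀ (by positivity) (by positivity)]
  -- After clearing denominators, `(1 + E)² = 1 + 2E + E²` with `E = exp x` is to be at most `E (2 +
  -- 2 exp (2c))`; this bounds the term `1`, and `h4` the term `E²`.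
  have h3 : 1 ≤ Real.exp x * Real.exp (2 * c) := by
    rw [← Real.exp_add]
    exact Real.one_le_exp (by linarith)
  have h4 : Real.exp x * Real.exp x ≤ Real.exp x * Real.exp (2 * c) := by
    gcongr
    linarith
  nlinarith

/-- The loss minus `ω/2 * (x - t)²` is still convex on `[-c, c]`, hence lies above its tangent at
`t`, where the quadratic has zero slope. -/
theorem logistic_loss_quadratic_lower_bound {c s t : ℝ} (hs : |s| ≤ c) (ht : |t| ≤ c) :
    Real.log (1 + Real.exp (-t)) - 1 / (1 + Real.exp t) * (s - t) +
      VNM.omegaConst c / 2 * (s - t) ^ 2 ≤ Real.log (1 + Real.exp (-s)) := by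
  set ω := VNM.omegaConst c with hω
  have hd : ∀ x, HasDerivAt (fun x => Real.log (1 + Real.exp (-x)) - ω / 2 * (x - t) ^ 2)
      (-(1 / (1 + Real.exp x)) - ω * (x - t)) x := by
    intro x
    have h1 : HasDerivAt (fun x : ℝ => ω / 2 * (x - t) ^ 2) (ω * (x - t)) x := by
      convert! (((hasDerivAt_id x).sub_const t).pow 2).const_mul (ω / 2) using 1
      simp
      ring
    exact (hasDerivAt_log_one_add_exp_neg x).sub h1
  have hd2 : ∀ x, HasDerivAt (fun x => -(1 / (1 + Real.exp x)) - ω * (x - t))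
      (Real.exp x / (1 + Real.exp x) ^ 2 - ω) x := by
    intro x
    have h1 : HasDerivAt (fun x : ℝ => ω * (x - t)) ω x := by
      simpa using ((hasDerivAt_id x).sub_const t).const_mul ω
    exact (hasDerivAt_neg_inv_one_add_exp x).sub h1
  have hconv : ConvexOn ℝ (Set.Icc (-c) c)
      (fun x => Real.log (1 + Real.exp (-x)) - ω / 2 * (x - t) ^ 2) := by
    refine convexOn_of_hasDerivWithinAt2_nonneg (convex_Icc _ _)
      (fun x _ => (hd x).continuousAt.continuousWithinAt) (fun x _ => (hd x).hasDerivWithinAt)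
      (fun x _ => (hd2 x).hasDerivWithinAt) fun x hx => ?_
    exact sub_nonneg.2 (omegaConst_le_logistic_deriv (abs_le.2 (Set.mem_Icc.1 (interior_subset hx))))
  have hs' : s ∈ Set.Icc (-c) c := abs_le.1 hs
  have ht' : t ∈ Set.Icc (-c) c := abs_le.1 ht
  have hdt := hd t
  rw [sub_self, mul_zero, sub_zero] at hdt
  rcases lt_trichotomy s t with hlt | heq | hlt
  · have h := hconv.slope_le_of_hasDerivAt hs' ht' hlt hdt
    rw [slope_def_field, div_le_iff₀ (by linarith), sub_self] at h
    linarith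
  · simp [heq]
  · have h := hconv.le_slope_of_hasDerivAt ht' hs' hlt hdt
    rw [slope_def_field, le_div_iff₀ (by linarith), sub_self] at h
    linarith

/-- The derivative of the log-likelihood of a logit response `z` at utility difference `t`. -/
noncomputable def logitScore (t z : ℝ) : ℝ := z / (1 + Real.exp (z * t))

theorem logit_loss_quadratic_lower_bound {c s t z : ℝ} (hs : |s| ≤ c) (ht : |t| ≤ c)
    (hz : z = 1 ∨ z = -1) :
    Real.log (1 + Real.exp (-z * t)) - logitScore t z * (s - t) +
      VNM.omegaConst c / 2 * (s - t) ^ 2 ≤ Real.log (1 + Real.exp (-z * s)) := by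
  unfold logitScore
  rcases hz with rfl | rfl
  · simpa using logistic_loss_quadratic_lower_bound hs ht
  · have h := logistic_loss_quadratic_lower_bound (s := -s) (t := -t) (c := c)
      (by rwa [abs_neg]) (by rwa [abs_neg])
    simp only [neg_neg, one_mul, neg_mul] at h ⊢
    convert h using 2
    · ring
    · ring

end Logistic

/-! ### Projection onto the column space -/

section RangeBasis

theorem exists_orthonormal_of_range {m n : Type*} [Fintype m] [Fintype n] [DecidableEq n]
    (P : Matrix m n ℝ) :
    ∃ e : Fin P.rank → m → ℝ,
      (∀ i j, ∑ k, e i k * e j k = if i = j then 1 else 0) ∧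
      ∀ x, ∃ a : Fin P.rank → ℝ, ∀ k, (P *ᵥ x) k = ∑ i, a i * e i k := by
  classical
  let f := WithLp.linearEquiv 2 ℝ (m → ℝ)
  let S : Submodule ℝ (EuclideanSpace ℝ m) :=
    (LinearMap.range P.mulVecLin).map (f.symm : (m → ℝ) →ₗ[ℝ] EuclideanSpace ℝ m)
  have hS : Module.finrank ℝ S = P.rank := by
    rw [Matrix.rank]
    exact LinearEquiv.finrank_map_eq f.symm _
  let B := (stdOrthonormalBasis ℝ S).reindex (finCongr hS)
  refine ⟨fun i k => (B i : EuclideanSpace ℝ m) k, fun i j => ?_, fun x => ?_⟩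
  · have h := orthonormal_iff_ite.1 B.orthonormal i j
    rw [← h, Submodule.coe_inner, PiLp.inner_apply]
    exact Finset.sum_congr rfl fun k _ => by simp [mul_comm]
  · have hx : f.symm (P *ᵥ x) ∈ S := Submodule.mem_map_of_mem ⟨x, rfl⟩
    refine ⟨fun i => B.repr ⟨_, hx⟩ i, fun k => ?_⟩
    have h := congrArg (fun y : S => (y : EuclideanSpace ℝ m) k) (B.sum_repr ⟨_, hx⟩)
    simp only [Submodule.coe_sum, WithLp.ofLp_sum, Finset.sum_apply] at h
    exact h.symm

theorem rank_infoMatrix {b : ℝ} {K : ℕ} (hK : 0 < K) (W Y : Fin K → VNM.Lottery b) :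
    (VNM.infoMatrix W Y).rank = (VNM.reducedMatrix W Y).rank := by
  have hK' : (1 / (K : ℝ)) ≠ 0 := by positivity
  rw [VNM.infoMatrix, Matrix.rank_smul_of_mem_nonZeroDivisors _
    (mem_nonZeroDivisors_of_ne_zero hK'), Matrix.rank_transpose_mul_self]

/-- In the coordinates `a` of `w`, Young's inequality `a S ≤ ω/4 * a² + S²/ω` lets half of the
quadratic term absorb the linear one. -/
theorem sum_sq_le_of_quadratic_le {ι κ : Type*} [Fintype ι] [Fintype κ] [DecidableEq ι]
    {e : ι → κ → ℝ} (he : ∀ i j, ∑ k, e i k * e j k = if i = j then 1 else 0)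
    {ω : ℝ} (hω : 0 < ω) {v w : κ → ℝ} {a : ι → ℝ} (hw : ∀ k, w k = ∑ i, a i * e i k)
    (h : ω / 2 * ∑ k, w k ^ 2 ≤ ∑ k, v k * w k) :
    ∑ k, w k ^ 2 ≤ 4 * (∑ i, (∑ k, e i k * v k) ^ 2) / ω ^ 2 := by
  have h1 : ∑ k, v k * w k = ∑ i, a i * ∑ k, e i k * v k := by
    simp only [hw, Finset.mul_sum]
    rw [Finset.sum_comm]
    exact Finset.sum_congr rfl fun i _ => Finset.sum_congr rfl fun k _ => by ring
  have h2 : ∑ k, w k ^ 2 = ∑ i, a i ^ 2 := by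
    have h3 : ∀ k, w k ^ 2 = ∑ i, ∑ j, a i * a j * (e i k * e j k) := by
      intro k
      rw [hw, sq, Finset.sum_mul_sum]
      exact Finset.sum_congr rfl fun i _ => Finset.sum_congr rfl fun j _ => by ring
    simp only [h3]
    rw [Finset.sum_comm]
    refine Finset.sum_congr rfl fun i _ => ?_
    rw [Finset.sum_comm]
    simp only [← Finset.mul_sum, he]
    simp [sq]
  rw [h1, h2] at h
  rw [h2]
  have h4 : ∑ i, a i * ∑ k, e i k * v k ≤
      ω / 4 * ∑ i, a i ^ 2 + 1 / ω * ∑ i, (∑ k, e i k * v k) ^ 2 := by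
    rw [Finset.mul_sum, Finset.mul_sum, ← Finset.sum_add_distrib]
    refine Finset.sum_le_sum fun i _ => ?_
    set S := ∑ k, e i k * v k
    have h5 : ω / 4 * a i ^ 2 + 1 / ω * S ^ 2 - a i * S = 1 / ω * (ω / 2 * a i - S) ^ 2 := by
      field_simp
      ring
    have : 0 ≤ 1 / ω * (ω / 2 * a i - S) ^ 2 := by positivity
    linarith
  have h6 : ω / 4 * ∑ i, a i ^ 2 ≤ 1 / ω * ∑ i, (∑ k, e i k * v k) ^ 2 := by linarith
  rw [one_div_mul_eq_div, le_div_iff₀ hω] at h6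
  rw [le_div_iff₀ (by positivity)]
  linarith

end RangeBasis

/-! ### Lotteries, breakpoints and likelihood in coordinates -/

namespace VNM

theorem Lottery.prob_nonneg {b : ℝ} (X : Lottery b) (y : ℝ) : 0 ≤ X.prob y := ENNReal.toReal_nonneg

theorem Lottery.prob_eq_zero {b : ℝ} (X : Lottery b) {y : ℝ} (hy : y ∉ X.supp) : X.prob y = 0 := by
  have h : X.law y = 0 := by
    rw [PMF.apply_eq_zero_iff]
    simpa [Lottery.supp] using hy
  simp [Lottery.prob, h]

theorem Lottery.sum_prob {b : ℝ} (X : Lottery b) : ∑ y ∈ X.supp, X.prob y = 1 := by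
  have h := X.law.tsum_coe
  rw [tsum_eq_sum (s := X.supp) fun y hy => by
    rw [PMF.apply_eq_zero_iff]
    simpa [Lottery.supp] using hy] at h
  simp only [Lottery.prob]
  rw [← ENNReal.toReal_sum fun y _ => X.law.apply_ne_top y, h, ENNReal.toReal_one]

section Breakpoints

variable {b : ℝ} {K : ℕ} (W Y : Fin K → Lottery b)

theorem supp_left_subset (k : Fin K) : (W k).supp ⊆ breakpoints W Y := by
  intro y hy
  simp only [breakpoints, Finset.mem_union, Finset.mem_biUnion]
  exact Or.inl (Or.inl (Or.inr ⟨k, Finset.mem_univ _, hy⟩))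

theorem supp_right_subset (k : Fin K) : (Y k).supp ⊆ breakpoints W Y := by
  intro y hy
  simp only [breakpoints, Finset.mem_union, Finset.mem_biUnion]
  exact Or.inl (Or.inr ⟨k, Finset.mem_univ _, hy⟩)

theorem mem_Icc_of_mem_breakpoints (hb : 0 < b) {y : ℝ} (hy : y ∈ breakpoints W Y) :
    y ∈ Set.Icc 0 b := by
  simp only [breakpoints, Finset.mem_union, Finset.mem_biUnion, Finset.mem_singleton] at hy
  rcases hy with ((rfl | ⟨k, _, hy⟩) | ⟨k, _, hy⟩) | rfl
  · exact ⟨le_rfl, hb.le⟩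
  · exact (W k).support_subset (by simpa [Lottery.supp] using hy)
  · exact (Y k).support_subset (by simpa [Lottery.supp] using hy)
  · exact ⟨hb.le, le_rfl⟩

theorem pt_mem (j : Fin (numPts W Y)) : pt W Y j ∈ breakpoints W Y :=
  Finset.orderEmbOfFin_mem _ _ _

theorem pt_strictMono : StrictMono (pt W Y) := ((breakpoints W Y).orderEmbOfFin rfl).strictMono

theorem pt_mem_Icc (hb : 0 < b) (j : Fin (numPts W Y)) : pt W Y j ∈ Set.Icc 0 b :=
  mem_Icc_of_mem_breakpoints W Y hb (pt_mem W Y j)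

theorem exists_pt_eq {y : ℝ} (hy : y ∈ breakpoints W Y) : ∃ j, pt W Y j = y := by
  have h := Finset.range_orderEmbOfFin (breakpoints W Y) rfl
  have hy' : y ∈ Set.range ((breakpoints W Y).orderEmbOfFin rfl) := by
    rw [h]
    exact hy
  exact hy'

theorem numPts_pos : 0 < numPts W Y :=
  Finset.card_pos.2 ⟨0, by simp [breakpoints]⟩

theorem pt_first (hb : 0 < b) (j : Fin (numPts W Y)) (hj : j.1 = 0) : pt W Y j = 0 := by
  obtain ⟨i, hi⟩ := exists_pt_eq W Y (y := 0) (by simp [breakpoints])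
  refine le_antisymm ?_ (pt_mem_Icc W Y hb j).1
  rw [← hi]
  exact (pt_strictMono W Y).monotone (Fin.le_def.2 (by omega))

theorem pt_last (hb : 0 < b) (j : Fin (numPts W Y)) (hj : j.1 + 1 = numPts W Y) :
    pt W Y j = b := by
  obtain ⟨i, hi⟩ := exists_pt_eq W Y (y := b) (by simp [breakpoints])
  refine le_antisymm (pt_mem_Icc W Y hb j).2 ?_
  exact hi.symm.le.trans ((pt_strictMono W Y).monotone (Fin.le_def.2 (by have := i.2; omega)))

theorem sum_pt (f : ℝ → ℝ) : ∑ j, f (pt W Y j) = ∑ y ∈ breakpoints W Y, f y := by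
  rw [← Finset.map_orderEmbOfFin_univ (breakpoints W Y) rfl, Finset.sum_map]
  rfl

theorem sum_prob_mul_pt {X : Lottery b} (hX : X.supp ⊆ breakpoints W Y) (u : ℝ → ℝ) :
    ∑ j, X.prob (pt W Y j) * u (pt W Y j) = X.expect u := by
  rw [sum_pt W Y fun y => X.prob y * u y, Lottery.expect]
  exact (Finset.sum_subset hX fun y _ hy => by rw [X.prob_eq_zero hy, zero_mul]).symm

theorem sum_prob_pt {X : Lottery b} (hX : X.supp ⊆ breakpoints W Y) :
    ∑ j, X.prob (pt W Y j) = 1 := by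
  have h := sum_prob_mul_pt W Y hX fun _ => 1
  simpa [Lottery.expect, X.sum_prob] using h

theorem sum_massDiff_adjustedValues (k : Fin K) (u : ℝ → ℝ) (σ : ℝ) :
    ∑ j, massDiff W Y k j * adjustedValues W Y u σ j =
      ((W k).expect u - (Y k).expect u) / σ := by
  rw [← sum_prob_mul_pt W Y (supp_left_subset W Y k),
    ← sum_prob_mul_pt W Y (supp_right_subset W Y k), ← Finset.sum_sub_distrib, Finset.sum_div]
  refine Finset.sum_congr rfl fun j _ => ?_
  simp only [massDiff, adjustedValues]
  ring

theorem abs_sum_massDiff_mul_le {c : ℝ} {α : Fin (numPts W Y) → ℝ}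
    (hα : ∀ j, α j ∈ Set.Icc 0 c) (k : Fin K) : |∑ j, massDiff W Y k j * α j| ≤ c := by
  have key : ∀ X : Lottery b, X.supp ⊆ breakpoints W Y →
      0 ≤ ∑ j, X.prob (pt W Y j) * α j ∧ ∑ j, X.prob (pt W Y j) * α j ≤ c := by
    intro X hX
    refine ⟨Finset.sum_nonneg fun j _ => mul_nonneg (X.prob_nonneg _) (hα j).1, ?_⟩
    calc ∑ j, X.prob (pt W Y j) * α j ≤ ∑ j, X.prob (pt W Y j) * c :=
          Finset.sum_le_sum fun j _ => mul_le_mul_of_nonneg_left (hα j).2 (X.prob_nonneg _)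
      _ = c := by rw [← Finset.sum_mul, sum_prob_pt W Y hX, one_mul]
  have h1 := key (W k) (supp_left_subset W Y k)
  have h2 := key (Y k) (supp_right_subset W Y k)
  simp only [massDiff, sub_mul, Finset.sum_sub_distrib]
  rw [abs_le]
  constructor <;> linarith

/-- Normalization at payoff `0` makes the dropped column harmless, so the vector of all pairings
lies in the range of the reduced matrix. -/
theorem reducedMatrix_mulVec {x : Fin (numPts W Y) → ℝ} (hx : ∀ j, j.1 = 0 → x j = 0)
    (k : Fin K) :
    (reducedMatrix W Y *ᵥ fun i => x (rightIdx W Y i)) k = ∑ j, massDiff W Y k j * x j := by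
  have key : ∀ n (hn : n = numPts W Y) (f : Fin (numPts W Y) → ℝ), (∀ j, j.1 = 0 → f j = 0) →
      ∑ i : Fin (n - 1), f ⟨i.1 + 1, by omega⟩ = ∑ j, f j := by
    intro n hn f hf
    subst hn
    obtain ⟨m, hm⟩ : ∃ m, numPts W Y = m + 1 := ⟨_, (Nat.succ_pred_eq_of_pos (numPts_pos W Y)).symm⟩
    rw [← (finCongr hm.symm).sum_comp, Fin.sum_univ_succ, hf _ (by simp), zero_add,
      ← (finCongr (show m = numPts W Y - 1 by omega)).sum_comp]
    rfl
  exact key _ rfl (fun j => massDiff W Y k j * x j) fun j hj => by rw [hx j hj, mul_zero]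

theorem dropFirst_mulVec (x : Fin (numPts W Y) → ℝ) :
    dropFirst W Y *ᵥ x = fun i => x (rightIdx W Y i) := by
  funext i
  simp [dropFirst, Matrix.mulVec, dotProduct]

theorem weightMatrix_quadratic_form (lam : ℝ) {x : Fin (numPts W Y) → ℝ}
    (hx : ∀ j, j.1 = 0 → x j = 0) :
    x ⬝ᵥ (weightMatrix W Y lam *ᵥ x) =
      1 / K * ∑ k, (∑ j, massDiff W Y k j * x j) ^ 2 + lam * ∑ i, x (rightIdx W Y i) ^ 2 := by
  set y : Fin (numPts W Y - 1) → ℝ := fun i => x (rightIdx W Y i) with hy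
  have h1 : x ⬝ᵥ (weightMatrix W Y lam *ᵥ x) = y ⬝ᵥ ((infoMatrix W Y + lam • 1) *ᵥ y) := by
    rw [weightMatrix, ← Matrix.mulVec_mulVec, ← Matrix.mulVec_mulVec, Matrix.dotProduct_mulVec,
      Matrix.vecMul_transpose, dropFirst_mulVec]
  rw [h1, Matrix.add_mulVec, dotProduct_add, infoMatrix, Matrix.smul_mulVec, Matrix.smul_mulVec,
    Matrix.one_mulVec, dotProduct_smul, dotProduct_smul, ← Matrix.mulVec_mulVec,
    Matrix.dotProduct_mulVec, Matrix.vecMul_transpose, smul_eq_mul, smul_eq_mul]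
  congr 2
  · exact Finset.sum_congr rfl fun k _ => by rw [reducedMatrix_mulVec W Y hx, sq]
  · exact Finset.sum_congr rfl fun i _ => by rw [sq]

theorem log_responseProb (u : ℝ → ℝ) (σ : ℝ) (k : Fin K) {z : ℝ} (hz : z = 1 ∨ z = -1) :
    Real.log (responseProb W Y u σ k z) = -Real.log (1 + Real.exp
      (∑ j, -z * massDiff W Y k j * adjustedValues W Y u σ j)) := by
  simp only [mul_assoc]
  rw [← Finset.mul_sum, sum_massDiff_adjustedValues, ← Real.log_inv, sub_div]
  congr 1
  have h1 := Real.exp_pos ((W k).expect u / σ)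
  have h2 := Real.exp_pos ((Y k).expect u / σ)
  rcases hz with rfl | rfl
  · rw [responseProb, if_pos rfl, neg_one_mul, neg_sub, Real.exp_sub]
    field_simp
  · rw [responseProb, if_neg (by norm_num), neg_neg, one_mul, Real.exp_sub]
    field_simp
    ring

/-- Puts the direct maximizer and the convex program on the same objective, which depends on `(u,
σ)` only through the adjusted values. -/
theorem logLikelihood_eq_programObjective (u : ℝ → ℝ) (σ : ℝ) {z : Fin K → ℝ}
    (hz : ∀ k, z k = 1 ∨ z k = -1) :
    logLikelihood W Y z u σ = programObjective W Y z (adjustedValues W Y u σ) := by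
  rw [logLikelihood, programObjective, ← Finset.sum_neg_distrib]
  exact Finset.sum_congr rfl fun k _ => log_responseProb W Y u σ k (hz k)

end Breakpoints

/-! ### Feasibility and existence for the convex program -/

section Feasibility

variable {b : ℝ} {K : ℕ} {W Y : Fin K → Lottery b} {L c : ℝ}

theorem adjustedValues_first (hb : 0 < b) {u : ℝ → ℝ} (hu : u ∈ utilitySet b L) (σ : ℝ)
    (j : Fin (numPts W Y)) (hj : j.1 = 0) : adjustedValues W Y u σ j = 0 := by
  rw [adjustedValues, pt_first W Y hb j hj, hu.2.2.2.1, zero_div]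

theorem one_div_le_of_one_div_le (hc : 0 < c) {σ : ℝ} (hσ : 1 / c ≤ σ) : 0 < σ ∧ 1 / σ ≤ c := by
  have h : 0 < σ := lt_of_lt_of_le (by positivity) hσ
  exact ⟨h, by rwa [one_div_le h hc]⟩

theorem adjustedValues_mem_Icc (hb : 0 < b) (hc : 0 < c) {u : ℝ → ℝ} (hu : u ∈ utilitySet b L)
    {σ : ℝ} (hσ : 1 / c ≤ σ) (j : Fin (numPts W Y)) :
    adjustedValues W Y u σ j ∈ Set.Icc 0 c := by
  obtain ⟨hmono, -, -, h0, h1⟩ := hu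
  obtain ⟨hpos, hle⟩ := one_div_le_of_one_div_le hc hσ
  have hj := pt_mem_Icc W Y hb j
  have hl := hmono ⟨le_rfl, hb.le⟩ hj hj.1
  have hr := hmono hj ⟨hb.le, le_rfl⟩ hj.2
  rw [h0] at hl
  rw [h1] at hr
  refine ⟨div_nonneg hl hpos.le, le_trans ?_ hle⟩
  unfold adjustedValues
  gcongr

/-- The slopes of a vector of values at the breakpoints. -/
noncomputable def slopes (α : Fin (numPts W Y) → ℝ) (i : Fin (numPts W Y - 1)) : ℝ :=
  (α (rightIdx W Y i) - α (leftIdx W Y i)) / (pt W Y (rightIdx W Y i) - pt W Y (leftIdx W Y i))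

theorem pt_left_lt_right (i : Fin (numPts W Y - 1)) :
    pt W Y (leftIdx W Y i) < pt W Y (rightIdx W Y i) :=
  pt_strictMono W Y (Fin.lt_def.2 (Nat.lt_succ_self _))

/-- Makes the truth a competitor in the convex program, with `γ = 1 / σ`. -/
theorem programFeasible_adjustedValues (hb : 0 < b) (hL : 0 < L) (hc : 0 < c) {u : ℝ → ℝ}
    (hu : u ∈ utilitySet b L) {σ : ℝ} (hσ : 1 / c ≤ σ) :
    ProgramFeasible W Y L c (adjustedValues W Y u σ) (slopes (adjustedValues W Y u σ))
      (1 / σ) := by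
  obtain ⟨hpos, hle⟩ := one_div_le_of_one_div_le hc hσ
  have hslope : ∀ i, slopes (adjustedValues W Y u σ) i =
      (u (pt W Y (rightIdx W Y i)) - u (pt W Y (leftIdx W Y i))) /
        (pt W Y (rightIdx W Y i) - pt W Y (leftIdx W Y i)) / σ := by
    intro i
    simp only [slopes, adjustedValues]
    rw [← sub_div, div_right_comm]
  refine ⟨fun i => rfl, fun i i' hi => ?_, fun i _ => ?_, fun i _ => ?_,
    adjustedValues_first hb hu σ, fun j hj => ?_, by positivity, hle⟩
  · rw [hslope, hslope]
    have hm : leftIdx W Y i' = rightIdx W Y i := Fin.ext hi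
    have h := pt_left_lt_right (W := W) (Y := Y) i'
    rw [hm] at h ⊢
    exact div_le_div_of_nonneg_right (hu.2.1.slope_anti_adjacent (pt_mem_Icc W Y hb _)
      (pt_mem_Icc W Y hb _) (pt_left_lt_right i) h) hpos.le
  · rw [hslope, mul_one_div]
    gcongr
    have h := pt_left_lt_right (W := W) (Y := Y) i
    rw [div_le_iff₀ (sub_pos.2 h)]
    have hlip := hu.2.2.1.dist_le_mul _ (pt_mem_Icc W Y hb (rightIdx W Y i)) _
      (pt_mem_Icc W Y hb (leftIdx W Y i))
    rw [Real.coe_toNNReal _ hL.le, Real.dist_eq, Real.dist_eq, abs_of_pos (sub_pos.2 h)] at hlip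
    exact (le_abs_self _).trans hlip
  · rw [hslope]
    have h := pt_left_lt_right (W := W) (Y := Y) i
    have := hu.1 (pt_mem_Icc W Y hb _) (pt_mem_Icc W Y hb _) h.le
    exact div_nonneg (div_nonneg (sub_nonneg.2 this) (sub_nonneg.2 h.le)) hpos.le
  · rw [adjustedValues, pt_last W Y hb j hj, hu.2.2.2.2]

/-- Backward induction from the last slope, the only one constrained directly; concavity makes
earlier slopes at least as large. -/
theorem ProgramFeasible.slope_nonneg {α : Fin (numPts W Y) → ℝ} {β : Fin (numPts W Y - 1) → ℝ}
    {γ : ℝ} (h : ProgramFeasible W Y L c α β γ) (i : Fin (numPts W Y - 1)) : 0 ≤ β i := by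
  have key : ∀ d : ℕ, ∀ i : Fin (numPts W Y - 1), i.1 + 1 + d = numPts W Y - 1 → 0 ≤ β i := by
    intro d
    induction d with
    | zero => exact fun i hi => h.monotone i hi
    | succ d ih =>
      intro i hi
      exact (ih ⟨i.1 + 1, by omega⟩ (by simp only; omega)).trans (h.concave i _ rfl)
  exact key (numPts W Y - 1 - (i.1 + 1)) i (by have := i.2; omega)

theorem ProgramFeasible.monotone_values {α : Fin (numPts W Y) → ℝ}
    {β : Fin (numPts W Y - 1) → ℝ} {γ : ℝ} (h : ProgramFeasible W Y L c α β γ) : Monotone α := by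
  have key : ∀ d : ℕ, ∀ i j : Fin (numPts W Y), i.1 + d = j.1 → α i ≤ α j := by
    intro d
    induction d with
    | zero =>
      intro i j hij
      rw [show i = j from Fin.ext hij]
    | succ d ih =>
      intro i j hij
      let l : Fin (numPts W Y - 1) := ⟨i.1 + d, by have := j.2; omega⟩
      have h1 : α i ≤ α (leftIdx W Y l) := ih _ _ rfl
      have h2 : rightIdx W Y l = j := Fin.ext (by simp [rightIdx, l]; omega)
      have h3 := h.slope_nonneg l
      rw [h.slope, le_div_iff₀ (sub_pos.2 (pt_left_lt_right l)), zero_mul, h2] at h3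
      linarith
  intro i j hij
  exact key (j.1 - i.1) i j (by have := Fin.le_def.1 hij; omega)

theorem ProgramFeasible.mem_Icc {α : Fin (numPts W Y) → ℝ} {β : Fin (numPts W Y - 1) → ℝ}
    {γ : ℝ} (h : ProgramFeasible W Y L c α β γ) (j : Fin (numPts W Y)) : α j ∈ Set.Icc 0 γ := by
  have hN := numPts_pos W Y
  constructor
  · rw [← h.first ⟨0, hN⟩ rfl]
    exact h.monotone_values (Fin.le_def.2 (Nat.zero_le _))
  · rw [← h.last ⟨numPts W Y - 1, by omega⟩ (by simp only; omega)]
    exact h.monotone_values (Fin.le_def.2 (by have := j.2; simp only; omega))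

theorem programFeasible_iff {α : Fin (numPts W Y) → ℝ} {β : Fin (numPts W Y - 1) → ℝ} {γ : ℝ} :
    ProgramFeasible W Y L c α β γ ↔ (∀ i, β i = slopes α i) ∧
      (∀ i i' : Fin (numPts W Y - 1), i'.1 = i.1 + 1 → β i' ≤ β i) ∧
      (∀ i, i.1 = 0 → β i ≤ L * γ) ∧ (∀ i, i.1 + 1 = numPts W Y - 1 → 0 ≤ β i) ∧
      (∀ j, j.1 = 0 → α j = 0) ∧ (∀ j, j.1 + 1 = numPts W Y → α j = γ) ∧ γ ∈ Set.Icc 0 c :=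
  ⟨fun h => ⟨h.1, h.2, h.3, h.4, h.5, h.6, h.7⟩,
    fun ⟨h1, h2, h3, h4, h5, h6, h7⟩ => ⟨h1, h2, h3, h4, h5, h6, h7⟩⟩

theorem continuous_slopes (i : Fin (numPts W Y - 1)) :
    Continuous fun α : Fin (numPts W Y) → ℝ => slopes α i := by
  unfold slopes
  fun_prop

/-- With `β` eliminated as a function of `α`, the constraints are closed, and monotonicity confines
`α` to the box `[0, c]^N`. -/
theorem isCompact_programFeasible :
    IsCompact {p : (Fin (numPts W Y) → ℝ) × ℝ | ProgramFeasible W Y L c p.1 (slopes p.1) p.2} := by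
  have hs : ∀ i, Continuous fun p : (Fin (numPts W Y) → ℝ) × ℝ => slopes p.1 i := fun i =>
    (continuous_slopes i).comp continuous_fst
  refine IsCompact.of_isClosed_subset
    ((isCompact_univ_pi fun _ => isCompact_Icc (a := 0) (b := c)).prod
      (isCompact_Icc (a := 0) (b := c))) ?_ fun p hp =>
    ⟨fun j _ => ⟨(hp.mem_Icc j).1, (hp.mem_Icc j).2.trans hp.range.2⟩, hp.range⟩
  simp only [programFeasible_iff, Set.ofPred_and, Set.ofPred_forall]
  refine IsClosed.inter ?_ (IsClosed.inter ?_ (IsClosed.inter ?_ (IsClosed.inter ?_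
    (IsClosed.inter ?_ (IsClosed.inter ?_ ?_)))))
  · exact isClosed_iInter fun i => isClosed_const
  · exact isClosed_iInter fun i => isClosed_iInter fun i' => isClosed_iInter fun _ =>
      isClosed_le (hs i') (hs i)
  · exact isClosed_iInter fun i => isClosed_iInter fun _ => isClosed_le (hs i) (by fun_prop)
  · exact isClosed_iInter fun i => isClosed_iInter fun _ => isClosed_le (by fun_prop) (hs i)
  · exact isClosed_iInter fun i => isClosed_iInter fun _ => isClosed_eq (by fun_prop) (by fun_prop)
  · exact isClosed_iInter fun i => isClosed_iInter fun _ => isClosed_eq (by fun_prop) (by fun_prop)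
  · exact isClosed_Icc.preimage continuous_snd

theorem exists_isProgramOptimal (hc : 0 < c) (z : Fin K → ℝ) :
    ∃ α β γ, IsProgramOptimal W Y L c z α β γ := by
  have hne : {p : (Fin (numPts W Y) → ℝ) × ℝ |
      ProgramFeasible W Y L c p.1 (slopes p.1) p.2}.Nonempty := by
    refine ⟨(0, 0), fun i => rfl, ?_, ?_, ?_, ?_, ?_, le_rfl, hc.le⟩ <;> simp [slopes]
  have hcont : Continuous fun p : (Fin (numPts W Y) → ℝ) × ℝ => programObjective W Y z p.1 := by
    unfold programObjective
    refine (continuous_finsetSum _ fun k _ => Continuous.log (by fun_prop) fun p => ?_).neg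
    positivity
  obtain ⟨p, hp, hmax⟩ := isCompact_programFeasible.exists_isMaxOn hne hcont.continuousOn
  refine ⟨p.1, slopes p.1, p.2, hp, fun α β γ h => ?_⟩
  have hβ : β = slopes α := funext h.slope
  exact hmax (a := (α, γ)) (show ProgramFeasible W Y L c α (slopes α) γ from hβ ▸ h)

theorem ProgramFeasible.adjusted_alphaHat {α : Fin (numPts W Y) → ℝ}
    {β : Fin (numPts W Y - 1) → ℝ} {γ : ℝ} (h : ProgramFeasible W Y L c α β γ) :
    adjusted (alphaHat α γ) (sigmaHat γ) = α := by
  funext j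
  simp only [adjusted, alphaHat, sigmaHat, inv_inv, ENNReal.toReal_ofReal h.range.1]
  rcases eq_or_ne γ 0 with hγ | hγ
  -- At `γ = 0` feasibility forces `α = 0`, so reading `α / σ` at `σ = ∞` as `0` loses nothing.
  · have := h.mem_Icc j
    rw [hγ] at this ⊢
    rw [mul_zero]
    exact le_antisymm this.1 this.2
  · field_simp

end Feasibility

/-! ### Deterministic error estimate -/

section ErrorEstimate

variable {b : ℝ} {K : ℕ} {W Y : Fin K → Lottery b} {L c : ℝ}

theorem omegaConst_pos (c : ℝ) : 0 < omegaConst c := by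
  unfold omegaConst
  positivity

/-- The quadratic lower bound summed over queries; `hobj` removes the loss values and leaves score
against curvature. -/
theorem sum_sq_error_le {z : Fin K → ℝ} (hz : ∀ k, z k = 1 ∨ z k = -1)
    {α α₀ : Fin (numPts W Y) → ℝ} (hα : ∀ j, α j ∈ Set.Icc 0 c) (hα₀ : ∀ j, α₀ j ∈ Set.Icc 0 c)
    (hobj : programObjective W Y z α₀ ≤ programObjective W Y z α) :
    omegaConst c / 2 * ∑ k, (∑ j, massDiff W Y k j * (α - α₀) j) ^ 2 ≤
      ∑ k, logitScore (∑ j, massDiff W Y k j * α₀ j) (z k) *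
        ∑ j, massDiff W Y k j * (α - α₀) j := by
  have hdiff : ∀ k, ∑ j, massDiff W Y k j * (α - α₀) j =
      ∑ j, massDiff W Y k j * α j - ∑ j, massDiff W Y k j * α₀ j := by
    intro k
    simp only [Pi.sub_apply, mul_sub, Finset.sum_sub_distrib]
  simp only [programObjective, mul_assoc, ← Finset.mul_sum] at hobj
  simp only [hdiff]
  have h := Finset.sum_le_sum fun k (_ : k ∈ Finset.univ) =>
    logit_loss_quadratic_lower_bound (abs_sum_massDiff_mul_le W Y hα k)
      (abs_sum_massDiff_mul_le W Y hα₀ k) (hz k)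
  rw [Finset.sum_add_distrib, Finset.sum_sub_distrib, ← Finset.mul_sum] at h
  linarith

/-- Squaring the right side gives `2d + m` plus a cross term at least `2d`. -/
theorem sqrt_four_mul_add_le {d m : ℝ} (hd : 0 ≤ d) (hm : 0 ≤ m) :
    Real.sqrt (4 * d + m) ≤ Real.sqrt d + Real.sqrt (d + m) := by
  have h1 := Real.sq_sqrt hd
  have h2 := Real.sq_sqrt (add_nonneg hd hm)
  have h3 : Real.sqrt d ≤ Real.sqrt (d + m) := Real.sqrt_le_sqrt (by linarith)
  have h4 := Real.sqrt_nonneg d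
  rw [Real.sqrt_le_left (by positivity)]
  nlinarith

theorem weightedNorm_error_le (hK : 0 < K) {lam δ : ℝ} (hlam : 0 < lam)
    (hδ : δ ∈ Set.Ioo (0 : ℝ) 1) {R : ℕ}
    {e : Fin R → Fin K → ℝ} (he : ∀ i j, ∑ k, e i k * e j k = if i = j then 1 else 0)
    (hrange : ∀ x, ∃ a : Fin R → ℝ, ∀ k, (reducedMatrix W Y *ᵥ x) k = ∑ i, a i * e i k)
    {z : Fin K → ℝ} (hz : ∀ k, z k = 1 ∨ z k = -1) {α α₀ : Fin (numPts W Y) → ℝ}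
    (hα : ∀ j, α j ∈ Set.Icc 0 c) (hα₀ : ∀ j, α₀ j ∈ Set.Icc 0 c)
    (hfirst : ∀ j, j.1 = 0 → α j = 0) (hfirst₀ : ∀ j, j.1 = 0 → α₀ j = 0)
    (hobj : programObjective W Y z α₀ ≤ programObjective W Y z α)
    (hscore : ∑ i, (∑ k, e i k * logitScore (∑ j, massDiff W Y k j * α₀ j) (z k)) ^ 2 ≤
      R + 2 * -Real.log δ) :
    weightedNorm (weightMatrix W Y lam) (α - α₀) ≤ errorBound R K (numPts W Y) c lam δ := by
  have hx : ∀ j, j.1 = 0 → (α - α₀) j = 0 := fun j hj => by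
    rw [Pi.sub_apply, hfirst j hj, hfirst₀ j hj, sub_zero]
  have hω := omegaConst_pos c
  have hK' : (0 : ℝ) < K := Nat.cast_pos.2 hK
  have hlog : 0 < -Real.log δ := neg_pos.2 (Real.log_neg hδ.1 hδ.2)
  obtain ⟨a, ha⟩ := hrange fun i => (α - α₀) (rightIdx W Y i)
  simp only [reducedMatrix_mulVec W Y hx] at ha
  have h1 := sum_sq_le_of_quadratic_le he hω ha (sum_sq_error_le hz hα hα₀ hobj)
  -- The tail bound obtained here does not need the term `2 √(-R log δ)`, so it is slack.
  have hdev : (R + 2 * -Real.log δ) / (omegaConst c ^ 2 * K) ≤ devTerm R K c δ := by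
    unfold devTerm
    gcongr
    have := Real.sqrt_nonneg (-(R : ℝ) * Real.log δ)
    linarith
  have hd0 : 0 ≤ devTerm R K c δ := le_trans (by positivity) hdev
  have h2 : 1 / (K : ℝ) * ∑ k, (∑ j, massDiff W Y k j * (α - α₀) j) ^ 2 ≤
      4 * devTerm R K c δ := by
    calc 1 / (K : ℝ) * ∑ k, (∑ j, massDiff W Y k j * (α - α₀) j) ^ 2
        ≤ 1 / K * (4 * (R + 2 * -Real.log δ) / omegaConst c ^ 2) := by
          refine mul_le_mul_of_nonneg_left (h1.trans ?_) (by positivity)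
          gcongr
      _ = 4 * ((R + 2 * -Real.log δ) / (omegaConst c ^ 2 * K)) := by
          field_simp
      _ ≤ 4 * devTerm R K c δ := by linarith
  have hN : ((numPts W Y - 1 : ℕ) : ℝ) = (numPts W Y : ℝ) - 1 := by
    rw [Nat.cast_sub (numPts_pos W Y), Nat.cast_one]
  have hN0 : 0 ≤ (numPts W Y : ℝ) - 1 := hN ▸ Nat.cast_nonneg _
  have h3 : ∑ i, (α - α₀) (rightIdx W Y i) ^ 2 ≤ (c * Real.sqrt ((numPts W Y : ℝ) - 1)) ^ 2 := by
    rw [mul_pow, Real.sq_sqrt hN0, ← hN]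
    refine (Finset.sum_le_card_nsmul Finset.univ _ (c ^ 2) fun i _ => ?_).trans_eq
      (by rw [Finset.card_univ, Fintype.card_fin, nsmul_eq_mul, mul_comm])
    have h4 := hα (rightIdx W Y i)
    have h5 := hα₀ (rightIdx W Y i)
    refine sq_le_sq' ?_ ?_ <;> rw [Pi.sub_apply] <;> linarith [h4.1, h4.2, h5.1, h5.2]
  rw [weightedNorm, weightMatrix_quadratic_form W Y lam hx, errorBound]
  refine le_trans (Real.sqrt_le_sqrt (add_le_add h2 (mul_le_mul_of_nonneg_left h3 hlam.le)))
    (sqrt_four_mul_add_le hd0 (by positivity))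

end ErrorEstimate

end VNM

/-! ### Distribution of the scores at the truth -/

theorem logitScore_one (t : ℝ) : logitScore t 1 = 1 - 1 / (1 + Real.exp (-t)) := by
  have := Real.exp_pos t
  rw [logitScore, one_mul, Real.exp_neg]
  field_simp
  ring

theorem logitScore_neg_one (t : ℝ) : logitScore t (-1) = -(1 / (1 + Real.exp (-t))) := by
  rw [logitScore, neg_one_mul, neg_div]

theorem measurable_logitScore (t : ℝ) : Measurable (logitScore t) := by
  unfold logitScore
  fun_prop

namespace VNM

theorem response_eq_one_or {b : ℝ} {K : ℕ} (W Y : Fin K → Lottery b) (u : ℝ → ℝ)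
    (eW eY : Fin K → ℝ) (k : Fin K) :
    response W Y u eW eY k = 1 ∨ response W Y u eW eY k = -1 := by
  unfold response
  split_ifs <;> simp

section Score

variable {b : ℝ} {K : ℕ} (W Y : Fin K → Lottery b) {u : ℝ → ℝ} {σ : ℝ}
  {Ω : Type*} [MeasurableSpace Ω] {μ : Measure Ω} [IsProbabilityMeasure μ]
  {εW εY : Fin K → Ω → ℝ}

theorem iIndepFun_logitScore (hεW : ∀ k, AEMeasurable (εW k) μ) (hεY : ∀ k, AEMeasurable (εY k) μ)
    (hindep : iIndepFun (Sum.elim εW εY) μ) (t : Fin K → ℝ) :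
    iIndepFun (fun k ω => logitScore (t k)
      (response W Y u (fun k => εW k ω) (fun k => εY k ω) k)) μ := by
  refine (iIndepFun_prodMk_of_sumElim hεW hεY hindep).comp
    (fun k p => logitScore (t k)
      (if (Y k).expect u + p.2 ≤ (W k).expect u + p.1 then 1 else -1)) fun k => ?_
  exact (measurable_logitScore _).comp (Measurable.ite
    (measurableSet_le (by fun_prop) (by fun_prop)) measurable_const measurable_const)

/-- The score equals `1 - p` or `-p` according to the choice, where `p` is the logit probability of
choosing the first lottery; it is therefore a centred indicator. -/
theorem hasSubgaussianMGF_logitScore (hσ : 0 < σ)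
    (hεW : ∀ k, HasLaw (εW k) (gumbelMeasure σ) μ) (hεY : ∀ k, HasLaw (εY k) (gumbelMeasure σ) μ)
    (hindep : iIndepFun (Sum.elim εW εY) μ) (k : Fin K) :
    HasSubgaussianMGF (fun ω => logitScore (((W k).expect u - (Y k).expect u) / σ)
      (response W Y u (fun k => εW k ω) (fun k => εY k ω) k)) (1 / 4) μ := by
  -- The total mass need not be computed: the measure is the law of a random variable.
  have hprob : IsProbabilityMeasure (gumbelMeasure σ) := by
    rw [← (hεW k).map_eq]
    exact Measure.isProbabilityMeasure_map (hεW k).aemeasurable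
  set d := (W k).expect u - (Y k).expect u
  have hpair : AEMeasurable (fun ω => (εW k ω, εY k ω)) μ :=
    (hεW k).aemeasurable.prodMk (hεY k).aemeasurable
  have hset : MeasurableSet {p : ℝ × ℝ | p.2 ≤ p.1 + d} :=
    measurableSet_le (by fun_prop) (by fun_prop)
  have hlaw : μ.map (fun ω => (εW k ω, εY k ω)) = (gumbelMeasure σ).prod (gumbelMeasure σ) := by
    rw [(hindep.indepFun (i := Sum.inl k) (j := Sum.inr k)
      (by simp)).map_prod_eq_prod_map_map (hεW k).aemeasurable (hεY k).aemeasurable]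
    exact congrArg₂ _ (hεW k).map_eq (hεY k).map_eq
  have hs : NullMeasurableSet {ω | εY k ω ≤ εW k ω + d} μ :=
    hpair.nullMeasurableSet_preimage hset
  have hp : μ.real {ω | εY k ω ≤ εW k ω + d} = 1 / (1 + Real.exp (-(d / σ))) := by
    have h := gumbelMeasure_prod_le hσ d
    rw [← hlaw, Measure.map_apply_of_aemeasurable hpair hset] at h
    rw [← neg_div]
    exact (congrArg ENNReal.toReal h).trans (ENNReal.toReal_ofReal (by positivity))
  classical
  convert hasSubgaussianMGF_ite hs hp using 1
  funext ω
  by_cases h : εY k ω ≤ εW k ω + d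
  · have hmem : ω ∈ {ω | εY k ω ≤ εW k ω + d} := h
    rw [if_pos hmem, response, if_pos (by linarith), logitScore_one]
  · have hmem : ω ∉ {ω | εY k ω ≤ εW k ω + d} := h
    rw [if_neg hmem, response, if_neg (by linarith), logitScore_neg_one]

end Score

end VNM

/-! ### The high-probability bound -/

theorem mainTheorem1
    (b L c : ℝ) (hb : 0 < b) (hL : 0 < L) (hc : 0 < c)
    (K : ℕ) (hK : 0 < K) (W Y : Fin K → VNM.Lottery b)
    (uStar : ℝ → ℝ) (hu : uStar ∈ VNM.utilitySet b L)
    (sigmaStar : ℝ) (hsigma : 1 / c ≤ sigmaStar)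
    {Ω : Type*} [MeasurableSpace Ω] (μ : Measure Ω) [IsProbabilityMeasure μ]
    (εW εY : Fin K → Ω → ℝ)
    (hεW : ∀ k, HasLaw (εW k) (VNM.gumbelMeasure sigmaStar) μ)
    (hεY : ∀ k, HasLaw (εY k) (VNM.gumbelMeasure sigmaStar) μ)
    (hindep : iIndepFun (Sum.elim εW εY) μ)
    (Z : Ω → Fin K → ℝ)
    (hZ : ∀ ω, Z ω = VNM.response W Y uStar (fun k => εW k ω) (fun k => εY k ω))
    (lam δ : ℝ) (hlam : 0 < lam) (hδ : δ ∈ Set.Ioo (0 : ℝ) 1) :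
    1 - δ ≤ μ.real {ω |
      (∃ α β γ, VNM.IsProgramOptimal W Y L c (Z ω) α β γ) ∧
      (∀ α β γ, VNM.IsProgramOptimal W Y L c (Z ω) α β γ →
        VNM.weightedNorm (VNM.weightMatrix W Y lam)
            (VNM.adjusted (VNM.alphaHat α γ) (VNM.sigmaHat γ) -
              VNM.adjustedValues W Y uStar sigmaStar) ≤
          VNM.errorBound (VNM.infoMatrix W Y).rank K (VNM.numPts W Y) c lam δ) ∧
      (∀ u σ, VNM.IsMLE W Y L c (Z ω) u σ →
        VNM.weightedNorm (VNM.weightMatrix W Y lam)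
            (VNM.adjustedValues W Y u σ - VNM.adjustedValues W Y uStar sigmaStar) ≤
          VNM.errorBound (VNM.infoMatrix W Y).rank K (VNM.numPts W Y) c lam δ)} := by
  obtain ⟨hσ, -⟩ := VNM.one_div_le_of_one_div_le hc hsigma
  obtain ⟨e, he, hrange⟩ := exists_orthonormal_of_range (VNM.reducedMatrix W Y)
  rw [rank_infoMatrix hK W Y]
  set α₀ := VNM.adjustedValues W Y uStar sigmaStar
  set t : Fin K → ℝ := fun k => ∑ j, VNM.massDiff W Y k j * α₀ j
  have hteq : ∀ k, t k = ((W k).expect uStar - (Y k).expect uStar) / sigmaStar := fun k =>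
    VNM.sum_massDiff_adjustedValues W Y k uStar sigmaStar
  have hz : ∀ ω k, Z ω k = 1 ∨ Z ω k = -1 := fun ω k => by
    rw [hZ]
    exact VNM.response_eq_one_or W Y _ _ _ k
  have hindepV : iIndepFun (fun k ω => logitScore (t k) (Z ω k)) μ := by
    simp only [hZ]
    exact VNM.iIndepFun_logitScore W Y (fun k => (hεW k).aemeasurable)
      (fun k => (hεY k).aemeasurable) hindep t
  have hsub : ∀ k, HasSubgaussianMGF (fun ω => logitScore (t k) (Z ω k)) (1 / 4) μ := by
    intro k
    simp only [hZ, hteq]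
    exact VNM.hasSubgaussianMGF_logitScore W Y hσ hεW hεY hindep k
  have htail := measure_sum_sq_gt_le _ hindepV hsub e he
    (neg_pos.2 (Real.log_neg hδ.1 hδ.2)).le
  rw [neg_neg, Real.exp_log hδ.1, Fintype.card_fin] at htail
  set bad : Set Ω := {ω | ((VNM.reducedMatrix W Y).rank : ℝ) + 2 * -Real.log δ <
    ∑ i, (∑ k, e i k * logitScore (t k) (Z ω k)) ^ 2}
  have hbad : μ.real bad ≤ δ := ENNReal.toReal_le_of_le_ofReal hδ.1.le htail
  have hα₀_mem := VNM.adjustedValues_mem_Icc (W := W) (Y := Y) hb hc hu hsigma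
  have hα₀_first := VNM.adjustedValues_first (W := W) (Y := Y) hb hu sigmaStar
  refine le_trans ?_ (measureReal_mono (μ := μ) (s₁ := badᶜ) fun ω hω => ?_)
  -- Subadditivity suffices, so no measurability of `bad` is required.
  · have h := measureReal_union_le (μ := μ) bad badᶜ
    rw [Set.union_compl_self, probReal_univ] at h
    linarith
  · have hscore : ∑ i, (∑ k, e i k * logitScore (t k) (Z ω k)) ^ 2 ≤
        (VNM.reducedMatrix W Y).rank + 2 * -Real.log δ := not_lt.1 fun h => hω h
    refine ⟨VNM.exists_isProgramOptimal hc _, fun α β γ hopt => ?_, fun u σ hmle => ?_⟩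
    · rw [hopt.1.adjusted_alphaHat]
      exact VNM.weightedNorm_error_le hK hlam hδ he hrange (hz ω)
        (fun j => ⟨(hopt.1.mem_Icc j).1, (hopt.1.mem_Icc j).2.trans hopt.1.range.2⟩) hα₀_mem
        hopt.1.first hα₀_first
        (hopt.2 _ _ _ (VNM.programFeasible_adjustedValues hb hL hc hu hsigma)) hscore
    · have hobj := hmle.2.2 uStar hu sigmaStar hsigma
      rw [VNM.logLikelihood_eq_programObjective W Y _ _ (hz ω),
        VNM.logLikelihood_eq_programObjective W Y _ _ (hz ω)] at hobj
      exact VNM.weightedNorm_error_le hK hlam hδ he hrange (hz ω)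
        (VNM.adjustedValues_mem_Icc hb hc hmle.1 hmle.2.1) hα₀_mem
        (VNM.adjustedValues_first hb hmle.1 σ) hα₀_first hobj hscore
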